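/- For $n\ge 0$, a function $f:\{0,1\}^n\to\mathbb R$ is called XOS if there is a finite nonempty set $C\subset[0,\infty)^n$ such that $f(x)=\max_{w\in C}\sum_{i=1}^n w_i x_i$ for all $x\in\{0,1\}^n$. Let $\|g\|_2=\bigl(2^{-n}\sum_{x\in\{0,1\}^n} g(x)^2\bigr)^{1/2}$, and for $\epsilon>0$ let $\deg^{\ell_2}_\epsilon(f)$, the $(\ell_2,\epsilon)$-approximate degree of $f$, be the smallest $d$ such that there is a real polynomial $p$ in $n$ variables of degree at most $d$ with $\|f-p\|_2\le\epsilon$. **Theorem.** There are absolute constants $a,b,c>0$ such that for every $0<\epsilon<\tfrac12$ there exist an integer $k$ with $a/\epsilon^2\le k\le b/\epsilon^2$ and an XOS function $f:\{0,1\}^k\to[0,1]$ with $\deg^{\ell_2}_\epsilon(f)\ge c/\epsilon$. (In short: $k=\Theta(1/\epsilon^2)$ and $\deg^{\ell_2}_\epsilon(f)=\Omega(1/\epsilon)$.) -/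

import Mathlib

namespace BooleanCube

/-- The `0/1` real vector of a point of the cube `{0,1}^n`. -/
def toReal {n : ℕ} (x : Fin n → Bool) : Fin n → ℝ :=
  fun i => if x i = true then 1 else 0

/-- `f` is XOS: a maximum of finitely many linear functions `x ↦ ∑ i, w i * x i`
with nonnegative weights (the clauses). `IsGreatest` forces the set `C` of clauses to be
nonempty. -/
def IsXOS {n : ℕ} (f : (Fin n → Bool) → ℝ) : Prop :=
  ∃ C : Finset (Fin n → ℝ), (∀ w ∈ C, ∀ i, 0 ≤ w i) ∧
    ∀ x, IsGreatest ((fun w : Fin n → ℝ => ∑ i, w i * toReal x i) '' (C : Set (Fin n → ℝ))) (f x)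

/-- The `ℓ₂` norm with respect to the uniform distribution on `{0,1}^n`. -/
noncomputable def l2Norm {n : ℕ} (g : (Fin n → Bool) → ℝ) : ℝ :=
  Real.sqrt ((∑ x, g x ^ 2) / 2 ^ n)

/-- The `(ℓ₂, ε)`-approximate degree of `f`: the smallest `d` such that some real polynomial `p`
of degree at most `d` satisfies `‖f - p‖₂ ≤ ε`. -/
noncomputable def approxDegree {n : ℕ} (ε : ℝ) (f : (Fin n → Bool) → ℝ) : ℕ :=
  sInf {d : ℕ | ∃ p : MvPolynomial (Fin n) ℝ, p.totalDegree ≤ d ∧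
    l2Norm (fun x => f x - MvPolynomial.eval (toReal x) p) ≤ ε}

end BooleanCube

/-!
A polynomial of degree `d` reacts little to block flips: for disjoint blocks, the Walsh character
of `S` changes sign only under the at most `#S` blocks meeting `S` oddly, so by Parseval the mean
squared changes of `p` under the flips of the blocks add up to at most `4 * d * ‖p‖₂²`.

Talagrand's random DNF, with `2 ^ m / 256` terms of width `m` in `m ^ 2` variables, reacts a lot.
Near the middle layer of the cube a bounded number of terms is satisfied on average, and flipping
a block of `m` variables changes a constant fraction of the satisfied terms, so each of `m`
disjoint blocks is sensitive at a constant fraction of the points. Replacing every term by the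
average of its variables and adding the clauses `(1 - 1 / m) * x i` turns the DNF into an XOS
function within `1 / m` of the constant `1 - 1 / m` off the origin, which still jumps by `1 / m`
where the DNF changes. Its flip energy has order `1 / m` and its variance order `1 / m ^ 2`, so
degree `d` and error `ε`, a small multiple of `1 / m`, force `1 / m ≲ d / m ^ 2`.
-/

namespace BooleanCube

open Finset
open scoped BigOperators

section UniformDistribution

variable {α β : Type*} [Fintype α] [Fintype β]

lemma mul_dens_le_expect {p : α → Prop} [DecidablePred p] {g : α → ℝ} {t : ℝ}
    (hg : ∀ a, 0 ≤ g a) (ht : ∀ a, p a → t ≤ g a) : t * dens {a | p a} ≤ 𝔼 a, g a := by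
  rw [← expect_indicator_one, mul_expect]
  refine expect_le_expect fun a _ => ?_
  by_cases ha : p a
  · simpa [ha] using ht a ha
  · simpa [ha] using hg a

lemma expect_dens_comm (r : α → β → Prop) [∀ a b, Decidable (r a b)] :
    𝔼 a, (dens {b | r a b} : ℝ) = 𝔼 b, (dens {a | r a b} : ℝ) := by
  simp only [← expect_indicator_one, coe_filter_univ, Set.indicator_apply, Set.mem_ofPred_eq]
  exact expect_comm ..

lemma dens_piFinset_const {τ : Type*} [Fintype τ] [DecidableEq τ] (A : Finset α) :
    (dens (Fintype.piFinset fun _ : τ => A) : ℝ) = dens A ^ Fintype.card τ := by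
  simp only [nnratCast_dens, Fintype.card_piFinset, Fintype.card_fun, prod_const, card_univ,
    Nat.cast_pow, div_pow]

lemma dens_piFinset_const_sdiff {τ : Type*} [Fintype τ] [DecidableEq τ] [DecidableEq α]
    (A C : Finset α) :
    (dens ((Fintype.piFinset fun _ : τ => A) \ Fintype.piFinset fun _ => C) : ℝ) =
      dens A ^ Fintype.card τ - dens (A ∩ C) ^ Fintype.card τ := by
  rw [← dens_piFinset_const, ← dens_piFinset_const, Fintype.piFinset_inter, eq_sub_iff_add_eq]
  exact_mod_cast dens_sdiff_add_dens_inter _ _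

lemma dens_compl [DecidableEq α] [Nonempty α] (A : Finset α) : (dens Aᶜ : ℝ) = 1 - dens A := by
  have h := dens_sdiff_add_dens_eq_dens (subset_univ A)
  rw [dens_univ, ← compl_eq_univ_sdiff] at h
  exact eq_sub_of_add_eq (mod_cast h)

lemma abs_dens_symmDiff_sub_dens_le [DecidableEq α] (A C : Finset α) :
    |(dens (symmDiff A C) : ℝ) - dens A| ≤ dens C := by
  have hle {X Y : Finset α} (h : X ⊆ Y ∪ C) : (dens X : ℝ) ≤ dens Y + dens C :=
    mod_cast (dens_le_dens h).trans (dens_union_le _ _)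
  have h₁ := hle (X := symmDiff A C) (Y := A) (by grind [mem_symmDiff])
  have h₂ := hle (X := A) (Y := symmDiff A C) (by grind [mem_symmDiff])
  exact abs_le.mpr ⟨by linarith, by linarith⟩

lemma dens_exists_mem_and_forall_notMem {τ : Type*} [Fintype τ] [DecidableEq τ] [DecidableEq α]
    [Nonempty α] (X Y : Finset α) :
    (dens {T : τ → α | (∃ t, T t ∈ X) ∧ ∀ t, T t ∉ Y} : ℝ) =
      (1 - dens Y) ^ Fintype.card τ - (1 - dens (X ∪ Y)) ^ Fintype.card τ := by
  have hsub : (Fintype.piFinset fun _ : τ => (X ∪ Y)ᶜ) ⊆ Fintype.piFinset fun _ => Yᶜ :=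
    Fintype.piFinset_subset _ _ fun _ => compl_subset_compl.mpr subset_union_right
  have hset : ({T : τ → α | (∃ t, T t ∈ X) ∧ ∀ t, T t ∉ Y} : Finset _) =
      (Fintype.piFinset fun _ => Yᶜ) \ Fintype.piFinset fun _ => (X ∪ Y)ᶜ := by
    ext T
    simp only [mem_filter_univ, mem_sdiff, Fintype.mem_piFinset, mem_compl, mem_union]
    grind
  rw [hset, ← dens_compl, ← dens_compl, ← dens_piFinset_const, ← dens_piFinset_const,
    eq_sub_iff_add_eq]
  exact_mod_cast dens_sdiff_add_dens_eq_dens hsub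

lemma half_mul_le_pow_sub_pow {u v : ℝ} {N : ℕ} (hu : 0 ≤ u) (hu1 : u ≤ 1) (huv : u ≤ v)
    (hN : N * (1 - u) ≤ 1 / 2) : N * (v - u) / 2 ≤ v ^ N - u ^ N := by
  have hhalf : 1 / 2 ≤ u ^ N := by
    have h := one_add_mul_sub_le_pow (by linarith : -1 ≤ u) N
    linarith
  have hgrow : u ^ N * (1 + N * (v - u)) ≤ v ^ N := by
    calc u ^ N * (1 + N * (v - u)) ≤ u ^ N * (1 + (v - u)) ^ N := by
          gcongr
          exact one_add_mul_le_pow (by linarith) N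
      _ = (u * (1 + (v - u))) ^ N := (mul_pow _ _ _).symm
      _ ≤ v ^ N := by
          gcongr
          nlinarith
  have : 0 ≤ N * (v - u) := mul_nonneg N.cast_nonneg (sub_nonneg.mpr huv)
  nlinarith

lemma half_mul_dens_sdiff_le {τ : Type*} [Fintype τ] [DecidableEq τ] [DecidableEq α] [Nonempty α]
    {X Y : Finset α} (h : Fintype.card τ * (dens (X ∪ Y) : ℝ) ≤ 1 / 2) :
    Fintype.card τ * (dens (X \ Y) : ℝ) / 2 ≤
      dens {T : τ → α | (∃ t, T t ∈ X) ∧ ∀ t, T t ∉ Y} := by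
  have hunion : (dens (X \ Y) : ℝ) = 1 - dens Y - (1 - dens (X ∪ Y)) := by
    have := dens_sdiff_add_dens X Y
    rw [← this]
    push_cast
    ring
  have hle : (dens (X ∪ Y) : ℝ) ≤ 1 := mod_cast dens_le_one
  rw [dens_exists_mem_and_forall_notMem, hunion]
  refine half_mul_le_pow_sub_pow (sub_nonneg.mpr hle) (sub_le_self _ (NNRat.cast_nonneg _)) ?_
    (by linarith)
  gcongr
  exact subset_union_right

end UniformDistribution

section Walsh

variable {ι : Type*}

/-- The Walsh character `x ↦ (-1) ^ ∑ i ∈ S, x i`: the Fourier basis of the cube. -/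
def walsh (S : Finset ι) (x : ι → Bool) : ℝ := ∏ i ∈ S, if x i then -1 else 1

lemma sum_walsh_mul_walsh [Fintype ι] (x y : ι → Bool) :
    ∑ S, walsh S x * walsh S y = if x = y then (2 : ℝ) ^ Fintype.card ι else 0 := by
  classical
  have hprod : ∑ S, walsh S x * walsh S y =
      ∏ i, (1 + (if x i then -1 else 1) * (if y i then -1 else 1) : ℝ) := by
    simp only [walsh, ← prod_mul_distrib]
    rw [prod_one_add, powerset_univ]
  rw [hprod]
  split_ifs with hxy
  · subst hxy
    rw [← card_univ, ← prod_const]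
    refine prod_congr rfl fun i _ => ?_
    cases x i <;> norm_num
  · obtain ⟨i, hi⟩ := Function.ne_iff.mp hxy
    refine prod_eq_zero (mem_univ i) ?_
    cases hx : x i <;> cases hy : y i <;> simp_all

variable [DecidableEq ι]

/-- The point obtained from `x` by flipping the coordinates in the block `B`. -/
def flipOn (B : Finset ι) (x : ι → Bool) : ι → Bool :=
  fun i => if i ∈ B then !x i else x i

lemma walsh_flipOn (S B : Finset ι) (x : ι → Bool) :
    walsh S (flipOn B x) = (-1) ^ #(S ∩ B) * walsh S x := by
  have hbit (i : ι) : (if flipOn B x i then -1 else 1 : ℝ) =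
      (if i ∈ B then -1 else 1) * if x i then -1 else 1 := by
    by_cases hi : i ∈ B <;> cases hx : x i <;> simp [flipOn, hi, hx]
  simp only [walsh, hbit, prod_mul_distrib, prod_ite, prod_const, one_pow, mul_one,
    filter_mem_eq_inter]

lemma flipOn_involutive (B : Finset ι) : Function.Involutive (flipOn B) := by
  intro x
  funext i
  by_cases hi : i ∈ B <;> simp [flipOn, hi]

lemma sum_one_sub_neg_one_pow_card_inter_sq_le {κ : Type*} [Fintype κ] {B : κ → Finset ι}
    (hB : Pairwise (Function.onFun Disjoint B)) (S : Finset ι) :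
    ∑ j, (1 - (-1 : ℝ) ^ #(S ∩ B j)) ^ 2 ≤ 4 * (#S : ℝ) := by
  have hterm (k : ℕ) : (1 - (-1 : ℝ) ^ k) ^ 2 ≤ 4 * k := by
    rcases Nat.even_or_odd k with hk | hk
    · simp [hk.neg_one_pow]
    · have : (1 : ℝ) ≤ k := mod_cast hk.pos
      rw [hk.neg_one_pow]
      linarith
  have hcard : ∑ j, #(S ∩ B j) ≤ #S := by
    rw [← card_biUnion fun j _ l _ hjl => (hB hjl).mono inter_subset_right inter_subset_right]
    exact card_le_card (biUnion_subset.mpr fun j _ => inter_subset_left)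
  calc ∑ j, (1 - (-1 : ℝ) ^ #(S ∩ B j)) ^ 2
      ≤ ∑ j, 4 * (#(S ∩ B j) : ℝ) :=
        sum_le_sum fun j _ => hterm _
    _ ≤ 4 * (#S : ℝ) := by
        rw [← mul_sum]
        gcongr
        exact_mod_cast hcard

variable [Fintype ι]

lemma expect_flipOn (B : Finset ι) (F : (ι → Bool) → ℝ) :
    𝔼 x, F (flipOn B x) = 𝔼 x, F x :=
  Fintype.expect_equiv (flipOn_involutive B).toPerm _ _ fun _ => rfl

/-- The Fourier coefficient of `F` at the Walsh character of `S`. -/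
noncomputable def walshCoeff (F : (ι → Bool) → ℝ) (S : Finset ι) : ℝ := 𝔼 x, F x * walsh S x

lemma walshCoeff_sub (F G : (ι → Bool) → ℝ) (S : Finset ι) :
    walshCoeff (fun x => F x - G x) S = walshCoeff F S - walshCoeff G S := by
  simp only [walshCoeff, sub_mul, expect_sub_distrib]

lemma walshCoeff_comp_flipOn (F : (ι → Bool) → ℝ) (B S : Finset ι) :
    walshCoeff (fun x => F (flipOn B x)) S = (-1) ^ #(S ∩ B) * walshCoeff F S := by
  rw [walshCoeff, ← expect_flipOn B]
  simp only [flipOn_involutive B _, walsh_flipOn, walshCoeff, mul_expect, mul_left_comm]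

lemma walshCoeff_eq_zero_of_flipOn_eq {F : (ι → Bool) → ℝ} {S : Finset ι} {i : ι}
    (hi : i ∈ S) (hF : ∀ x, F (flipOn {i} x) = F x) : walshCoeff F S = 0 := by
  have h := walshCoeff_comp_flipOn F {i} S
  simp only [hF, inter_singleton_of_mem hi, card_singleton, pow_one] at h
  linarith

lemma walshCoeff_walsh (S T : Finset ι) :
    walshCoeff (walsh S) T = if S = T then 1 else 0 := by
  have hzero {S T : Finset ι} {i : ι} (hT : i ∈ T) (hS : i ∉ S) : walshCoeff (walsh S) T = 0 :=
    walshCoeff_eq_zero_of_flipOn_eq hT fun x => by simp [walsh_flipOn, hS]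
  split_ifs with h
  · subst h
    have hsq (x : ι → Bool) : walsh S x * walsh S x = 1 := by
      rw [walsh, ← prod_mul_distrib]
      exact prod_eq_one fun i _ => by split_ifs <;> norm_num
    simp [walshCoeff, hsq]
  · obtain ⟨i, hi⟩ := not_forall.mp (mt Finset.ext h)
    rw [not_iff] at hi
    by_cases hT : i ∈ T
    · exact hzero hT (by tauto)
    · simpa only [walshCoeff, mul_comm] using hzero (S := T) (T := S) (i := i) (by tauto) hT

theorem sum_walshCoeff_sq (F : (ι → Bool) → ℝ) : ∑ S, walshCoeff F S ^ 2 = 𝔼 x, F x ^ 2 := by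
  calc ∑ S, walshCoeff F S ^ 2
      = ∑ S, 𝔼 x, 𝔼 y, F x * F y * (walsh S x * walsh S y) := by
        simp only [walshCoeff, sq, expect_mul_expect, mul_mul_mul_comm]
    _ = 𝔼 x, 𝔼 y, F x * F y * ∑ S, walsh S x * walsh S y := by
        simp only [← expect_sum_comm, mul_sum]
    _ = 𝔼 x, F x ^ 2 := by
        refine expect_congr rfl fun x _ => ?_
        rw [Fintype.expect_eq_sum_div_card]
        simp [sum_walsh_mul_walsh, sq]

/-- The mean squared change of `F` when the block `B` of a uniform point is flipped. For
`B = {i}` this is four times the influence of the coordinate `i`. -/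
noncomputable def flipEnergy (B : Finset ι) (F : (ι → Bool) → ℝ) : ℝ :=
  𝔼 x, (F x - F (flipOn B x)) ^ 2

lemma flipEnergy_eq_sum_walshCoeff (B : Finset ι) (F : (ι → Bool) → ℝ) :
    flipEnergy B F = ∑ S, (1 - (-1) ^ #(S ∩ B)) ^ 2 * walshCoeff F S ^ 2 := by
  simp only [flipEnergy, ← sum_walshCoeff_sq, walshCoeff_sub, walshCoeff_comp_flipOn,
    ← one_sub_mul, mul_pow]

theorem sum_flipEnergy_le {κ : Type*} [Fintype κ] {B : κ → Finset ι}
    (hB : Pairwise (Function.onFun Disjoint B)) {F : (ι → Bool) → ℝ} {d : ℕ}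
    (hF : ∀ S, d < #S → walshCoeff F S = 0) :
    ∑ j, flipEnergy (B j) F ≤ 4 * d * 𝔼 x, F x ^ 2 := by
  simp only [flipEnergy_eq_sum_walshCoeff]
  rw [sum_comm, ← sum_walshCoeff_sq, mul_sum]
  refine sum_le_sum fun S _ => ?_
  rw [← sum_mul]
  rcases lt_or_ge d #S with hS | hS
  · simp [hF S hS]
  · gcongr
    exact (sum_one_sub_neg_one_pow_card_inter_sq_le hB S).trans (by gcongr)

lemma flipEnergy_le (B : Finset ι) (F : (ι → Bool) → ℝ) :
    flipEnergy B F ≤ 4 * 𝔼 x, F x ^ 2 := by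
  calc flipEnergy B F ≤ 𝔼 x, 2 * (F x ^ 2 + F (flipOn B x) ^ 2) :=
        expect_le_expect fun x _ => by nlinarith [sq_nonneg (F x + F (flipOn B x))]
    _ = 4 * 𝔼 x, F x ^ 2 := by
        rw [← mul_expect, expect_add_distrib, expect_flipOn B fun x => F x ^ 2]
        ring

lemma flipEnergy_sub_const (B : Finset ι) (F : (ι → Bool) → ℝ) (c : ℝ) :
    flipEnergy B (fun x => F x - c) = flipEnergy B F := by
  simp only [flipEnergy, sub_sub_sub_cancel_right]

lemma flipEnergy_le_of_approx (B : Finset ι) (F G : (ι → Bool) → ℝ) :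
    flipEnergy B F ≤ 8 * 𝔼 x, (F x - G x) ^ 2 + 2 * flipEnergy B G := by
  have hsplit : flipEnergy B F ≤ 2 * (flipEnergy B (fun x => F x - G x) + flipEnergy B G) := by
    simp only [flipEnergy, ← expect_add_distrib, mul_expect]
    refine expect_le_expect fun x _ => le_trans (le_of_eq ?_) add_sq_le
    ring
  linarith [flipEnergy_le B fun x => F x - G x]

lemma sq_mul_dens_le_flipEnergy {A : (ι → Bool) → Bool} {F : (ι → Bool) → ℝ} {s : ℝ} (hs : 0 ≤ s)
    (hgap : ∀ x y, A x = true → A y = false → s ≤ F x - F y) (B : Finset ι) :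
    s ^ 2 * dens {x | A x ≠ A (flipOn B x)} ≤ flipEnergy B F := by
  refine mul_dens_le_expect (fun x => sq_nonneg _) fun x hx => ?_
  cases hAx : A x
  · rw [sub_sq_comm]
    exact pow_le_pow_left₀ hs (hgap _ _ (by simpa [hAx] using hx.symm) hAx) 2
  · exact pow_le_pow_left₀ hs (hgap _ _ hAx (by simpa [hAx] using hx.symm)) 2

end Walsh

section Ones

variable {ι : Type*} [Fintype ι]

/-- The set of coordinates at which `x` is one. -/
def ones (x : ι → Bool) : Finset ι := {i | x i}

lemma sum_walsh_singleton (x : ι → Bool) :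
    ∑ i, walsh {i} x = Fintype.card ι - 2 * (#(ones x) : ℝ) := by
  have hbit (i : ι) : walsh {i} x = 1 - 2 * if x i then 1 else 0 := by
    rw [walsh, prod_singleton]
    split_ifs <;> norm_num
  simp only [hbit, sum_sub_distrib, ← mul_sum, sum_boole, ones, sum_const, card_univ, nsmul_eq_mul,
    mul_one]

variable [DecidableEq ι]

lemma ones_flipOn (B : Finset ι) (x : ι → Bool) : ones (flipOn B x) = symmDiff (ones x) B := by
  ext i
  by_cases hi : i ∈ B <;> simp [ones, flipOn, mem_symmDiff, hi]

lemma expect_sq_sum_walsh_singleton :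
    𝔼 x : ι → Bool, (∑ i, walsh {i} x) ^ 2 = (Fintype.card ι : ℝ) := by
  calc 𝔼 x : ι → Bool, (∑ i, walsh {i} x) ^ 2
      = ∑ i : ι, ∑ j, walshCoeff (walsh {i}) {j} := by
        simp only [sq, sum_mul_sum, expect_sum_comm, walshCoeff]
    _ = (Fintype.card ι : ℝ) := by simp [walshCoeff_walsh]

theorem expect_sq_dens_ones_sub_half [Nonempty ι] :
    𝔼 x : ι → Bool, ((dens (ones x) : ℝ) - 1 / 2) ^ 2 = 1 / (4 * (Fintype.card ι : ℝ)) := by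
  have hcard : (Fintype.card ι : ℝ) ≠ 0 := mod_cast Fintype.card_ne_zero
  have hdens (x : ι → Bool) : ((dens (ones x) : ℝ) - 1 / 2) ^ 2 =
      1 / (4 * (Fintype.card ι : ℝ) ^ 2) * (∑ i, walsh {i} x) ^ 2 := by
    rw [sum_walsh_singleton, nnratCast_dens]
    field_simp
    ring
  simp only [hdens, ← mul_expect, expect_sq_sum_walsh_singleton]
  field_simp

theorem three_quarters_le_dens_abs_dens_ones_sub_half_le [Nonempty ι] {s : ℝ} (hs : 0 ≤ s)
    (hcard : 1 ≤ s ^ 2 * Fintype.card ι) :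
    3 / 4 ≤ (dens {x : ι → Bool | |(dens (ones x) : ℝ) - 1 / 2| ≤ s} : ℝ) := by
  have hpos : 0 < (Fintype.card ι : ℝ) := mod_cast Fintype.card_pos
  have hchebyshev : s ^ 2 * dens {x : ι → Bool | ¬ |(dens (ones x) : ℝ) - 1 / 2| ≤ s} ≤
      1 / (4 * (Fintype.card ι : ℝ)) := by
    rw [← expect_sq_dens_ones_sub_half]
    refine mul_dens_le_expect (fun x => sq_nonneg _) fun x hx => ?_
    exact (pow_le_pow_left₀ hs (not_le.mp hx).le 2).trans_eq (sq_abs _)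
  rw [← compl_filter, dens_compl] at hchebyshev
  have hle := dens_le_one (s := ({x | |(dens (ones x) : ℝ) - 1 / 2| ≤ s} : Finset (ι → Bool)))
  rw [le_div_iff₀ (by positivity)] at hchebyshev
  have hnonneg : (0 : ℝ) ≤ 1 - dens {x : ι → Bool | |(dens (ones x) : ℝ) - 1 / 2| ≤ s} :=
    sub_nonneg.mpr (mod_cast hle)
  nlinarith

end Ones

section Estimates

lemma exp_neg_two_mul_le_pow {t : ℝ} {m : ℕ} (ht : 0 ≤ t) (htm : 2 * t ≤ m) :
    Real.exp (-2 * t) ≤ (1 - t / m) ^ m := by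
  rcases m.eq_zero_or_pos with rfl | hm
  · obtain rfl : t = 0 := by
      rw [Nat.cast_zero] at htm
      linarith
    simp
  have hm' : (0 : ℝ) < m := mod_cast hm
  have hu : t / m ≤ 1 / 2 := by
    rw [div_le_iff₀ hm']
    linarith
  have hbase : Real.exp (-2 * (t / m)) ≤ 1 - t / m := by
    have hu0 : 0 ≤ t / m := by positivity
    have h := Real.add_one_le_exp (2 * (t / m))
    rw [show -2 * (t / m) = -(2 * (t / m)) by ring, Real.exp_neg]
    refine inv_le_of_inv_le₀ (by linarith) ?_
    refine le_trans ?_ h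
    rw [inv_le_iff_one_le_mul₀ (by linarith)]
    nlinarith
  calc Real.exp (-2 * t) = Real.exp (-2 * (t / m)) ^ m := by
        rw [← Real.exp_nat_mul]
        congr 1
        field_simp
    _ ≤ (1 - t / m) ^ m := by gcongr

lemma exp_four_le : Real.exp 4 ≤ 64 := by
  calc Real.exp 4 = Real.exp 1 ^ 4 := by rw [← Real.exp_nat_mul]; norm_num
    _ ≤ 2.7182818286 ^ 4 := by gcongr; exact Real.exp_one_lt_d9.le
    _ ≤ 64 := by norm_num

lemma exp_neg_half_le : Real.exp (-(1 / 2)) ≤ 2 / 3 := by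
  rw [Real.exp_neg]
  refine inv_le_of_inv_le₀ (by norm_num) ?_
  linarith [Real.add_one_le_exp (1 / 2)]

lemma two_pow_mul_pow_le {p : ℝ} {m : ℕ} (hp : 0 ≤ p) (hpm : p ≤ 1 / 2 + 2 / m) :
    2 ^ m * p ^ m ≤ 64 := by
  have h := Real.one_sub_div_pow_le_exp_neg (n := m) (t := -4)
    (by linarith [m.cast_nonneg (α := ℝ)])
  calc 2 ^ m * p ^ m = (2 * p) ^ m := (mul_pow ..).symm
    _ ≤ (1 - -4 / m) ^ m := by
        gcongr
        linear_combination 2 * hpm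
    _ ≤ Real.exp 4 := by simpa using h
    _ ≤ 64 := exp_four_le

lemma exp_neg_eight_div_three_le {p q : ℝ} {m : ℕ} (hm : 8 ≤ m) (hp : |p - 1 / 2| ≤ 2 / m)
    (hq : 0 ≤ q) (hqp : q ≤ p - 1 / (2 * m)) :
    Real.exp (-8) / 3 ≤ 2 ^ m * p ^ m - 2 ^ m * q ^ m := by
  have hm' : (8 : ℝ) ≤ m := mod_cast hm
  have hsmall : 2 / (m : ℝ) ≤ 1 / 4 := by
    rw [div_le_iff₀ (by linarith)]
    linarith
  obtain ⟨hlow, hhigh⟩ := abs_le.mp hp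
  have hlower : Real.exp (-8) ≤ (2 * p) ^ m := by
    calc Real.exp (-8) ≤ (1 - 4 / m) ^ m := by
          simpa [show (-2 : ℝ) * 4 = -8 by norm_num] using
            exp_neg_two_mul_le_pow (t := 4) (m := m) (by norm_num) (by linarith)
      _ ≤ (2 * p) ^ m := by
          gcongr
          · linear_combination 2 * hsmall
          · linear_combination 2 * hlow
  have hratio : q ≤ p * (1 - 1 / 2 / m) := by
    have hinv : 0 ≤ 1 / (2 * (m : ℝ)) := by positivity
    rw [div_div]
    nlinarith
  have hp0 : 0 ≤ p := by linarith
  have hupper : (2 * q) ^ m ≤ (2 * p) ^ m * (2 / 3) := by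
    calc (2 * q) ^ m ≤ (2 * p * (1 - 1 / 2 / m)) ^ m :=
          pow_le_pow_left₀ (by linarith) (by linarith) m
      _ = (2 * p) ^ m * (1 - 1 / 2 / m) ^ m := mul_pow ..
      _ ≤ (2 * p) ^ m * (2 / 3) := by
          gcongr
          exact (Real.one_sub_div_pow_le_exp_neg (by linarith)).trans exp_neg_half_le
  rw [← mul_pow, ← mul_pow]
  linarith

end Estimates

section RandomDNF

variable {ι τ : Type*} [Fintype τ] {m : ℕ}

/-- The monotone DNF whose terms are the conjunctions of the variables `T t 0, …, T t (m - 1)`,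
repetitions being allowed. A uniformly random `T` gives Talagrand's random DNF. -/
def dnf (T : τ → Fin m → ι) (x : ι → Bool) : Bool := decide (∃ t, ∀ l, x (T t l))

variable [Fintype ι]

lemma dnf_eq_true_iff (T : τ → Fin m → ι) (x : ι → Bool) :
    dnf T x ↔ ∃ t, T t ∈ Fintype.piFinset fun _ => ones x := by
  simp [dnf, ones]

variable [DecidableEq ι]

lemma le_dens_dnf_and_not_dnf [DecidableEq τ] (hm : 8 ≤ m)
    (hτ : Fintype.card τ * 256 = 2 ^ m) {x y : ι → Bool}
    (hx : |(dens (ones x) : ℝ) - 1 / 2| ≤ 2 / m) (hy : |(dens (ones y) : ℝ) - 1 / 2| ≤ 2 / m)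
    (hxy : 1 / (2 * m) ≤ (dens (ones x \ ones y) : ℝ)) :
    Real.exp (-8) / 1536 ≤ dens {T : τ → Fin m → ι | dnf T x ∧ ¬ dnf T y} := by
  have hm0 : (0 : ℝ) < m := mod_cast (by lia : 0 < m)
  obtain ⟨i, -⟩ : (ones x \ ones y).Nonempty := by
    rw [← dens_pos, ← NNRat.cast_pos (K := ℝ)]
    exact lt_of_lt_of_le (by positivity) hxy
  have : Nonempty ι := ⟨i⟩
  set X := Fintype.piFinset fun _ : Fin m => ones x
  set Y := Fintype.piFinset fun _ : Fin m => ones y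
  have hcard : (Fintype.card τ : ℝ) = 2 ^ m / 256 := by
    rw [eq_div_iff (by norm_num)]
    exact_mod_cast hτ
  have hbound {z : ι → Bool} (hz : |(dens (ones z) : ℝ) - 1 / 2| ≤ 2 / m) :
      2 ^ m * (dens (Fintype.piFinset fun _ : Fin m => ones z) : ℝ) ≤ 64 := by
    rw [dens_piFinset_const, Fintype.card_fin]
    exact two_pow_mul_pow_le (NNRat.cast_nonneg _) (by linarith [(abs_le.mp hz).2])
  -- Few enough terms that the union bound over the terms loses only a factor of two.
  have hunion : Fintype.card τ * (dens (X ∪ Y) : ℝ) ≤ 1 / 2 := by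
    have h : (dens (X ∪ Y) : ℝ) ≤ dens X + dens Y := mod_cast dens_union_le X Y
    calc Fintype.card τ * (dens (X ∪ Y) : ℝ) ≤ 2 ^ m / 256 * (dens X + dens Y) := by
          rw [hcard]
          gcongr
      _ ≤ 1 / 2 := by linarith [hbound hx, hbound hy]
  have hsdiff : Real.exp (-8) / 3 ≤ 2 ^ m * (dens (X \ Y) : ℝ) := by
    rw [dens_piFinset_const_sdiff, Fintype.card_fin, mul_sub]
    refine exp_neg_eight_div_three_le hm hx (NNRat.cast_nonneg _) ?_
    have h : (dens (ones x \ ones y) + dens (ones x ∩ ones y) : ℝ) = dens (ones x) :=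
      mod_cast dens_sdiff_add_dens_inter _ _
    linarith
  have hmain := half_mul_dens_sdiff_le hunion
  simp only [dnf_eq_true_iff, not_exists]
  rw [hcard] at hmain
  linarith

theorem le_dens_dnf_ne_dnf_flipOn [DecidableEq τ] (hm : 8 ≤ m)
    (hτ : Fintype.card τ * 256 = 2 ^ m) {x : ι → Bool} {B : Finset ι}
    (hx : |(dens (ones x) : ℝ) - 1 / 2| ≤ 1 / m) (hB : (dens B : ℝ) = 1 / m) :
    Real.exp (-8) / 1536 ≤ dens {T : τ → Fin m → ι | dnf T x ≠ dnf T (flipOn B x)} := by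
  set S := ones x with hS
  have hremoved : S \ symmDiff S B = S ∩ B := by grind [mem_symmDiff]
  have hadded : symmDiff S B \ S = B \ S := by grind [mem_symmDiff]
  have hB_split : (dens (S ∩ B) + dens (B \ S) : ℝ) = 1 / m := by
    rw [← hB, inter_comm]
    exact_mod_cast dens_inter_add_dens_sdiff B S
  have hhalf : (1 / m : ℝ) = 1 / (2 * m) + 1 / (2 * m) := by
    field_simp
    norm_num
  have htwo : (2 / m : ℝ) = 1 / m + 1 / m := by ring
  have hx' : |(dens S : ℝ) - 1 / 2| ≤ 2 / m := by
    linarith [abs_nonneg ((dens S : ℝ) - 1 / 2)]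
  have hy' : |(dens (ones (flipOn B x)) : ℝ) - 1 / 2| ≤ 2 / m := by
    rw [ones_flipOn, htwo]
    refine (abs_sub_le _ (dens S : ℝ) _).trans (add_le_add ?_ hx)
    exact hB ▸ abs_dens_symmDiff_sub_dens_le S B
  rcases le_or_gt (1 / (2 * m) : ℝ) (dens (S ∩ B)) with h | h
  · refine (le_dens_dnf_and_not_dnf hm hτ hx' hy' ?_).trans ?_
    · rwa [ones_flipOn, ← hS, hremoved]
    · gcongr
      grind
  · refine (le_dens_dnf_and_not_dnf hm hτ hy' hx' ?_).trans ?_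
    · rw [ones_flipOn, ← hS, hadded]
      linarith
    · gcongr
      grind

theorem exists_dnf_sensitive (hm : 8 ≤ m) (hτ : Fintype.card τ * 256 = 2 ^ m)
    (hι : m ^ 2 ≤ Fintype.card ι) {κ : Type*} [Fintype κ] {B : κ → Finset ι}
    (hB : ∀ j, (dens (B j) : ℝ) = 1 / m) :
    ∃ T : τ → Fin m → ι, Fintype.card κ * (Real.exp (-8) / 2048) ≤
      ∑ j, (dens {x | dnf T x ≠ dnf T (flipOn (B j) x)} : ℝ) := by
  classical
  have hm0 : 0 < m := by lia
  have : Nonempty ι := Fintype.card_pos_iff.mp (lt_of_lt_of_le (by positivity) hι)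
  have hmiddle : 3 / 4 ≤ (dens {x : ι → Bool | |(dens (ones x) : ℝ) - 1 / 2| ≤ 1 / m} : ℝ) := by
    refine three_quarters_le_dens_abs_dens_ones_sub_half_le (by positivity) ?_
    rw [one_div_pow, one_div_mul_eq_div, one_le_div (by positivity)]
    exact_mod_cast hι
  have hblock (j : κ) : Real.exp (-8) / 2048 ≤
      𝔼 T : τ → Fin m → ι, (dens {x | dnf T x ≠ dnf T (flipOn (B j) x)} : ℝ) := by
    rw [expect_dens_comm]
    refine le_trans ?_ (mul_dens_le_expect (fun x => NNRat.cast_nonneg _) fun x hx =>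
      le_dens_dnf_ne_dnf_flipOn hm hτ hx (hB j))
    linarith [mul_le_mul_of_nonneg_left hmiddle (by positivity : 0 ≤ Real.exp (-8) / 1536)]
  obtain ⟨T, -, hT⟩ := exists_le_of_le_expect (s := (univ : Finset (τ → Fin m → ι)))
    univ_nonempty (a := Fintype.card κ * (Real.exp (-8) / 2048))
    (f := fun T => ∑ j, (dens {x | dnf T x ≠ dnf T (flipOn (B j) x)} : ℝ)) (by
      rw [expect_sum_comm, ← nsmul_eq_mul, ← card_univ, ← sum_const]
      exact sum_le_sum fun j _ => hblock j)
  exact ⟨T, hT⟩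

end RandomDNF

section PolynomialDegree

variable {n : ℕ}

lemma walshCoeff_eval_eq_zero {p : MvPolynomial (Fin n) ℝ} {S : Finset (Fin n)}
    (hS : p.totalDegree < #S) : walshCoeff (fun x => MvPolynomial.eval (toReal x) p) S = 0 := by
  simp only [walshCoeff, MvPolynomial.eval_eq, sum_mul]
  rw [expect_sum_comm]
  refine sum_eq_zero fun e he => ?_
  have hcard : #e.support < #S := by
    refine lt_of_le_of_lt ?_ ((MvPolynomial.le_totalDegree he).trans_lt hS)
    rw [Finsupp.sum, card_eq_sum_ones]
    exact sum_le_sum fun i hi => Nat.one_le_iff_ne_zero.mpr (Finsupp.mem_support_iff.mp hi)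
  obtain ⟨i, hiS, hie⟩ := exists_mem_notMem_of_card_lt_card hcard
  refine walshCoeff_eq_zero_of_flipOn_eq hiS fun x => ?_
  congr 1
  refine prod_congr rfl fun l hl => ?_
  have : l ≠ i := ne_of_mem_of_not_mem hl hie
  simp [toReal, flipOn, this]

lemma exists_eval_eq (f : (Fin n → Bool) → ℝ) :
    ∃ p : MvPolynomial (Fin n) ℝ, ∀ x, MvPolynomial.eval (toReal x) p = f x := by
  refine ⟨∑ a, MvPolynomial.C (f a) *
    ∏ i, if a i then MvPolynomial.X i else 1 - MvPolynomial.X i, fun x => ?_⟩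
  simp only [map_sum, map_mul, MvPolynomial.eval_C, map_prod]
  rw [sum_eq_single_of_mem x (mem_univ x)]
  · rw [prod_eq_one, mul_one]
    intro i _
    cases h : x i <;> simp [toReal, h]
  · intro a _ hax
    obtain ⟨i, hi⟩ := Function.ne_iff.mp hax
    rw [prod_eq_zero (mem_univ i), mul_zero]
    cases hx : x i <;> cases ha : a i <;> simp_all [toReal]

lemma l2Norm_sq (g : (Fin n → Bool) → ℝ) : l2Norm g ^ 2 = 𝔼 x, g x ^ 2 := by
  rw [l2Norm, Real.sq_sqrt (by positivity), Fintype.expect_eq_sum_div_card]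
  simp

lemma exists_totalDegree_le_approxDegree {ε : ℝ} (hε : 0 ≤ ε) (f : (Fin n → Bool) → ℝ) :
    ∃ p : MvPolynomial (Fin n) ℝ, p.totalDegree ≤ approxDegree ε f ∧
      𝔼 x, (f x - MvPolynomial.eval (toReal x) p) ^ 2 ≤ ε ^ 2 := by
  have hmem : approxDegree ε f ∈ {d : ℕ | ∃ p : MvPolynomial (Fin n) ℝ, p.totalDegree ≤ d ∧
      l2Norm (fun x => f x - MvPolynomial.eval (toReal x) p) ≤ ε} := by
    obtain ⟨p, hp⟩ := exists_eval_eq f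
    exact Nat.sInf_mem ⟨p.totalDegree, p, le_rfl, by simpa [hp, l2Norm] using hε⟩
  obtain ⟨p, hdeg, hp⟩ := hmem
  refine ⟨p, hdeg, ?_⟩
  rw [← l2Norm_sq]
  exact pow_le_pow_left₀ (Real.sqrt_nonneg _) hp 2

theorem sum_flipEnergy_le_approxDegree {κ : Type*} [Fintype κ] {B : κ → Finset (Fin n)}
    (hB : Pairwise (Function.onFun Disjoint B)) {ε : ℝ} (hε : 0 ≤ ε) (f : (Fin n → Bool) → ℝ)
    (c : ℝ) : ∑ j, flipEnergy (B j) f ≤ 8 * Fintype.card κ * ε ^ 2 +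
      16 * approxDegree ε f * (ε ^ 2 + 𝔼 x, (f x - c) ^ 2) := by
  obtain ⟨p, hdeg, hp⟩ := exists_totalDegree_le_approxDegree hε f
  set P : (Fin n → Bool) → ℝ := fun x => MvPolynomial.eval (toReal x) p
  have hcoeff (S : Finset (Fin n)) (hS : approxDegree ε f < #S) :
      walshCoeff (fun x => P x - c) S = 0 := by
    simpa [P] using walshCoeff_eval_eq_zero
      (((MvPolynomial.totalDegree_sub_C_le p c).trans hdeg).trans_lt hS)
  have hcentered : 𝔼 x, (P x - c) ^ 2 ≤ 2 * (ε ^ 2 + 𝔼 x, (f x - c) ^ 2) := by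
    calc 𝔼 x, (P x - c) ^ 2 ≤ 𝔼 x, 2 * ((f x - P x) ^ 2 + (f x - c) ^ 2) := by
          refine expect_le_expect fun x _ => ?_
          nlinarith [sq_nonneg (f x - P x + (f x - c))]
      _ ≤ 2 * (ε ^ 2 + 𝔼 x, (f x - c) ^ 2) := by
          rw [← mul_expect, expect_add_distrib]
          gcongr
  calc ∑ j, flipEnergy (B j) f
      ≤ ∑ j, (8 * ε ^ 2 + 2 * flipEnergy (B j) (fun x => P x - c)) := by
        refine sum_le_sum fun j _ => (flipEnergy_le_of_approx (B j) f P).trans ?_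
        rw [flipEnergy_sub_const]
        gcongr
    _ = 8 * Fintype.card κ * ε ^ 2 + 2 * ∑ j, flipEnergy (B j) (fun x => P x - c) := by
        rw [sum_add_distrib, sum_const, ← mul_sum, card_univ, nsmul_eq_mul]
        ring
    _ ≤ 8 * Fintype.card κ * ε ^ 2 +
          2 * (4 * approxDegree ε f * (2 * (ε ^ 2 + 𝔼 x, (f x - c) ^ 2))) := by
        gcongr
        exact (sum_flipEnergy_le hB hcoeff).trans (by gcongr)
    _ = _ := by ring

theorem one_le_approxDegree_toReal {ε : ℝ} (hε : 0 ≤ ε) (hε2 : ε < 1 / 2) (i : Fin n) :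
    1 ≤ approxDegree ε fun x => toReal x i := by
  rw [Nat.one_le_iff_ne_zero]
  intro hzero
  obtain ⟨p, hdeg, hp⟩ := exists_totalDegree_le_approxDegree hε fun x : Fin n → Bool => toReal x i
  rw [hzero, Nat.le_zero, MvPolynomial.totalDegree_eq_zero_iff_eq_C] at hdeg
  rw [hdeg] at hp
  simp only [MvPolynomial.eval_C] at hp
  have henergy := flipEnergy_le {i} fun x => toReal x i - MvPolynomial.coeff 0 p
  have hone : flipEnergy {i} (fun x => toReal x i - MvPolynomial.coeff 0 p) = 1 := by
    rw [flipEnergy, ← expect_const (s := (univ : Finset (Fin n → Bool))) univ_nonempty (1 : ℝ)]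
    refine expect_congr rfl fun x _ => ?_
    rw [sub_sub_sub_cancel_right]
    cases hx : x i <;> simp [toReal, flipOn, hx]
  nlinarith

end PolynomialDegree

section XOS

variable {n m : ℕ} {τ : Type*}

lemma toReal_nonneg (x : Fin n → Bool) (i : Fin n) : 0 ≤ toReal x i := by
  unfold toReal
  split_ifs <;> norm_num

lemma toReal_le_one (x : Fin n → Bool) (i : Fin n) : toReal x i ≤ 1 := by
  unfold toReal
  split_ifs <;> norm_num

lemma isXOS_linear {w : Fin n → ℝ} (hw : ∀ i, 0 ≤ w i) : IsXOS fun x => ∑ i, w i * toReal x i :=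
  ⟨{w}, by simpa using hw, fun x => by simp⟩

lemma isXOS_mul_toReal {c : ℝ} (hc : 0 ≤ c) (i : Fin n) : IsXOS fun x => c * toReal x i := by
  have hw (j : Fin n) : 0 ≤ Pi.single (M := fun _ => ℝ) i c j :=
    (Pi.single_nonneg.mpr hc : (0 : Fin n → ℝ) ≤ Pi.single i c) j
  simpa [Pi.single_apply] using isXOS_linear hw

lemma exists_isXOS_one_le_approxDegree {ε : ℝ} (hε : 0 ≤ ε) (hε2 : ε < 1 / 2) (i : Fin n) :
    ∃ f : (Fin n → Bool) → ℝ, (∀ x, f x ∈ Set.Icc (0 : ℝ) 1) ∧ IsXOS f ∧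
      1 ≤ approxDegree ε f :=
  ⟨fun x => toReal x i, fun x => ⟨toReal_nonneg x i, toReal_le_one x i⟩,
    by simpa using isXOS_mul_toReal zero_le_one i, one_le_approxDegree_toReal hε hε2 i⟩

lemma IsXOS.sup {f g : (Fin n → Bool) → ℝ} (hf : IsXOS f) (hg : IsXOS g) : IsXOS (f ⊔ g) := by
  classical
  obtain ⟨C, hC, hf⟩ := hf
  obtain ⟨D, hD, hg⟩ := hg
  refine ⟨C ∪ D, fun w hw => (mem_union.mp hw).elim (hC w) (hD w), fun x => ?_⟩
  rw [coe_union, Set.image_union]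
  exact (hf x).union (hg x)

lemma isXOS_sup' {κ : Type*} {s : Finset κ} (hs : s.Nonempty) {f : κ → (Fin n → Bool) → ℝ}
    (hf : ∀ j ∈ s, IsXOS (f j)) : IsXOS (s.sup' hs f) :=
  sup'_induction hs f (fun _ hg _ hh => hg.sup hh) hf

/-- The fraction of the literals `h 0, …, h (m - 1)` that are satisfied at `x`: the linear
relaxation of the conjunction of these literals. -/
noncomputable def satisfiedFraction (h : Fin m → Fin n) (x : Fin n → Bool) : ℝ :=
  (∑ l, toReal x (h l)) / m

lemma isXOS_satisfiedFraction (h : Fin m → Fin n) : IsXOS (satisfiedFraction h) := by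
  have hw (i : Fin n) : 0 ≤ ∑ l, if h l = i then 1 / (m : ℝ) else 0 :=
    sum_nonneg fun l _ => by positivity
  convert isXOS_linear hw using 2 with x
  simp only [sum_mul]
  rw [sum_comm]
  simp [satisfiedFraction, sum_div, inv_mul_eq_div]

lemma satisfiedFraction_le_one (h : Fin m → Fin n) (x : Fin n → Bool) :
    satisfiedFraction h x ≤ 1 :=
  div_le_one_of_le₀ ((sum_le_sum fun l _ => toReal_le_one x (h l)).trans (by simp)) m.cast_nonneg

lemma satisfiedFraction_eq_one [NeZero m] {h : Fin m → Fin n} {x : Fin n → Bool}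
    (hx : ∀ l, x (h l)) : satisfiedFraction h x = 1 := by
  simp [satisfiedFraction, toReal, hx]

lemma satisfiedFraction_le_one_sub {h : Fin m → Fin n} {x : Fin n → Bool} {l : Fin m}
    (hl : ¬ x (h l)) : satisfiedFraction h x ≤ 1 - 1 / m := by
  have hm : (0 : ℝ) < m := mod_cast l.pos
  rw [satisfiedFraction, one_sub_div hm.ne']
  gcongr
  rw [← sum_erase _ (a := l) (by simp [toReal, hl])]
  refine (sum_le_sum fun l _ => toReal_le_one x (h l)).trans ?_
  simp [Nat.cast_sub l.pos]

variable [Fintype τ] [Nonempty τ] [NeZero n]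

/-- The XOS function that rounds the DNF `T`: it is `1` where `T` accepts and `1 - 1 / m` at every
other point except the origin, where it vanishes. -/
noncomputable def roundedDNF (T : τ → Fin m → Fin n) : (Fin n → Bool) → ℝ :=
  univ.sup' univ_nonempty (fun t => satisfiedFraction (T t)) ⊔
    univ.sup' univ_nonempty fun i x => (1 - 1 / m) * toReal x i

lemma isXOS_roundedDNF (T : τ → Fin m → Fin n) : IsXOS (roundedDNF T) :=
  (isXOS_sup' _ fun t _ => isXOS_satisfiedFraction (T t)).sup <|
    isXOS_sup' _ fun i _ => isXOS_mul_toReal (by simp [Nat.cast_inv_le_one]) i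

lemma roundedDNF_le_iff {T : τ → Fin m → Fin n} {x : Fin n → Bool} {a : ℝ} :
    roundedDNF T x ≤ a ↔
      (∀ t, satisfiedFraction (T t) x ≤ a) ∧ ∀ i, (1 - 1 / m) * toReal x i ≤ a := by
  simp [roundedDNF, Finset.sup'_apply]

lemma one_sub_le_roundedDNF (T : τ → Fin m → Fin n) {x : Fin n → Bool} {i : Fin n} (hi : x i) :
    1 - 1 / m ≤ roundedDNF T x := by
  have h := ((roundedDNF_le_iff (T := T) (x := x)).mp le_rfl).2 i
  rwa [toReal, if_pos hi, mul_one] at h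

lemma roundedDNF_mem_Icc (T : τ → Fin m → Fin n) (x : Fin n → Bool) :
    roundedDNF T x ∈ Set.Icc (0 : ℝ) 1 := by
  have hone_sub : 0 ≤ 1 - 1 / (m : ℝ) := by simp [Nat.cast_inv_le_one]
  have hcoord (i : Fin n) : (1 - 1 / m : ℝ) * toReal x i ≤ 1 :=
    mul_le_one₀ (by simp) (toReal_nonneg x i) (toReal_le_one x i)
  exact ⟨(mul_nonneg hone_sub (toReal_nonneg x 0)).trans ((roundedDNF_le_iff.mp le_rfl).2 0),
    roundedDNF_le_iff.mpr ⟨fun t => satisfiedFraction_le_one (T t) x, hcoord⟩⟩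

lemma roundedDNF_le_one_sub {T : τ → Fin m → Fin n} {x : Fin n → Bool} (hx : ¬ dnf T x) :
    roundedDNF T x ≤ 1 - 1 / m := by
  simp only [dnf, decide_eq_true_eq, not_exists, not_forall] at hx
  refine roundedDNF_le_iff.mpr ⟨fun t => ?_, fun i => ?_⟩
  · obtain ⟨l, hl⟩ := hx t
    exact satisfiedFraction_le_one_sub hl
  · exact mul_le_of_le_one_right (by simp [Nat.cast_inv_le_one]) (toReal_le_one x i)

lemma roundedDNF_eq_one [NeZero m] {T : τ → Fin m → Fin n} {x : Fin n → Bool} (hx : dnf T x) :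
    roundedDNF T x = 1 := by
  simp only [dnf, decide_eq_true_eq] at hx
  obtain ⟨t, ht⟩ := hx
  refine le_antisymm (roundedDNF_mem_Icc T x).2 ?_
  rw [← satisfiedFraction_eq_one ht]
  exact (roundedDNF_le_iff.mp le_rfl).1 t

lemma sq_mul_dens_le_flipEnergy_roundedDNF [NeZero m] (T : τ → Fin m → Fin n)
    (B : Finset (Fin n)) : (1 / (m : ℝ)) ^ 2 * dens {x | dnf T x ≠ dnf T (flipOn B x)} ≤
      flipEnergy B (roundedDNF T) := by
  refine sq_mul_dens_le_flipEnergy (by positivity) (fun x y hx hy => ?_) B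
  rw [roundedDNF_eq_one hx]
  linarith [roundedDNF_le_one_sub (Bool.eq_false_iff.mp hy)]

lemma expect_sq_roundedDNF_sub_le (T : τ → Fin m → Fin n) :
    𝔼 x, (roundedDNF T x - (1 - 1 / m)) ^ 2 ≤ 1 / (m : ℝ) ^ 2 + 1 / 2 ^ n := by
  calc 𝔼 x, (roundedDNF T x - (1 - 1 / m)) ^ 2
      ≤ 𝔼 x : Fin n → Bool, (1 / (m : ℝ) ^ 2 + if x = fun _ => false then 1 else 0) := by
        refine expect_le_expect fun x _ => ?_
        obtain ⟨h0, h1⟩ := roundedDNF_mem_Icc T x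
        have hinv0 : 0 ≤ 1 / (m : ℝ) := by positivity
        have hinv1 : 1 / (m : ℝ) ≤ 1 := by simp [Nat.cast_inv_le_one]
        rw [← one_div_pow]
        split_ifs with hx
        · nlinarith
        · obtain ⟨i, hi⟩ := Function.ne_iff.mp hx
          have hlow := one_sub_le_roundedDNF T (i := i) (by simpa using hi)
          nlinarith
    _ = 1 / (m : ℝ) ^ 2 + 1 / 2 ^ n := by
        rw [expect_add_distrib, expect_const univ_nonempty, Fintype.expect_eq_sum_div_card]
        simp

end XOS

section Conclusion

lemma exists_pairwise_disjoint_dens_eq (m : ℕ) : ∃ B : Fin m → Finset (Fin (m * m)),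
    Pairwise (Function.onFun Disjoint B) ∧ ∀ j, (dens (B j) : ℝ) = 1 / m := by
  have hinj (j : Fin m) : Function.Injective fun l : Fin m => finProdFinEquiv (j, l) :=
    fun _ _ h => congrArg Prod.snd (finProdFinEquiv.injective h)
  refine ⟨fun j => univ.image fun l => finProdFinEquiv (j, l), fun j k hjk => ?_, fun j => ?_⟩
  · simp only [Function.onFun, disjoint_left, mem_image, mem_univ, true_and]
    rintro _ ⟨l, rfl⟩ ⟨l', h⟩
    exact hjk (congrArg Prod.fst (finProdFinEquiv.injective h)).symm
  · rw [nnratCast_dens, card_image_of_injective _ (hinj j)]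
    simp [div_self_mul_self']

/-- The constant `c` in the lower bound `c * m` for the approximate degree of the rounded random
DNF of width `m`. The factor `exp (-8) / 2048` is the block sensitivity of the DNF per block, and
`1 / 96` is what remains of it after the approximation error is subtracted. -/
noncomputable def degreeConst : ℝ := Real.exp (-8) / 2048 / 96

lemma degreeConst_pos : 0 < degreeConst := by unfold degreeConst; positivity

lemma degreeConst_le_one : degreeConst ≤ 1 := by
  have h : Real.exp (-8) ≤ 1 := Real.exp_le_one_iff.mpr (by norm_num)
  unfold degreeConst
  linarith

lemma mul_le_of_energy_le {m δ ε d : ℝ} (hm : 0 < m) (hδ1 : δ ≤ 1) (hε : 0 ≤ ε) (hεm : ε * m ≤ δ)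
    (hd : 0 ≤ d)
    (h : (1 / m) ^ 2 * (m * (96 * δ)) ≤ 8 * m * ε ^ 2 + 16 * d * (ε ^ 2 + 2 / m ^ 2)) :
    δ * m ≤ d := by
  have hsq : (ε * m) ^ 2 ≤ δ :=
    (pow_le_of_le_one (by positivity) (hεm.trans hδ1) two_ne_zero).trans hεm
  have hscaled : m * (96 * δ) ≤ 8 * m * (ε * m) ^ 2 + 16 * d * ((ε * m) ^ 2 + 2) := by
    have := mul_le_mul_of_nonneg_right h (sq_nonneg m)
    field_simp at this
    linarith
  have hle : m * (96 * δ) ≤ 8 * m * δ + 16 * d * (1 + 2) := hscaled.trans (by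
    gcongr
    exact hsq.trans hδ1)
  have hδm : 0 ≤ δ * m := mul_nonneg ((by positivity : 0 ≤ ε * m).trans hεm) hm.le
  linarith

theorem exists_isXOS_approxDegree_ge {m : ℕ} (hm : 8 ≤ m) {ε : ℝ} (hε : 0 ≤ ε)
    (hεm : ε * m ≤ degreeConst) :
    ∃ f : (Fin (m * m) → Bool) → ℝ, (∀ x, f x ∈ Set.Icc (0 : ℝ) 1) ∧ IsXOS f ∧
      degreeConst * m ≤ approxDegree ε f := by
  have : NeZero m := ⟨by lia⟩
  obtain ⟨B, hB, hdens⟩ := exists_pairwise_disjoint_dens_eq m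
  have hτ : Fintype.card (Fin (m - 8) → Bool) * 256 = 2 ^ m := by
    rw [Fintype.card_fun, Fintype.card_bool, Fintype.card_fin, show 256 = 2 ^ 8 by norm_num,
      ← pow_add, Nat.sub_add_cancel hm]
  obtain ⟨T, hT⟩ := exists_dnf_sensitive hm hτ (by simp [sq]) hdens
  refine ⟨roundedDNF T, roundedDNF_mem_Icc T, isXOS_roundedDNF T, ?_⟩
  have hlower : (1 / (m : ℝ)) ^ 2 * (m * (96 * degreeConst)) ≤
      ∑ j, flipEnergy (B j) (roundedDNF T) := by
    calc (1 / (m : ℝ)) ^ 2 * (m * (96 * degreeConst))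
        ≤ (1 / (m : ℝ)) ^ 2 * ∑ j, (dens {x | dnf T x ≠ dnf T (flipOn (B j) x)} : ℝ) := by
          gcongr
          simpa [degreeConst, mul_div_cancel₀] using hT
      _ ≤ ∑ j, flipEnergy (B j) (roundedDNF T) := by
          rw [mul_sum]
          exact sum_le_sum fun j _ => sq_mul_dens_le_flipEnergy_roundedDNF T (B j)
  have hvar : 𝔼 x, (roundedDNF T x - (1 - 1 / m)) ^ 2 ≤ 2 / (m : ℝ) ^ 2 := by
    have h : (m : ℝ) ^ 2 ≤ 2 ^ (m * m) := by
      rw [sq]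
      exact_mod_cast Nat.lt_two_pow_self.le
    calc _ ≤ 1 / (m : ℝ) ^ 2 + 1 / 2 ^ (m * m) := expect_sq_roundedDNF_sub_le T
      _ ≤ 1 / (m : ℝ) ^ 2 + 1 / (m : ℝ) ^ 2 := by gcongr
      _ = 2 / (m : ℝ) ^ 2 := by ring
  have hupper := sum_flipEnergy_le_approxDegree hB hε (roundedDNF T) (1 - 1 / m)
  rw [Fintype.card_fin] at hupper
  exact mul_le_of_energy_le (mod_cast NeZero.pos m) degreeConst_le_one hε hεm (Nat.cast_nonneg _)
    (hlower.trans (hupper.trans (by gcongr)))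

lemma exists_nat_mul_mem_Icc {ε c : ℝ} {k : ℕ} (hk : 0 < k) (hε : 0 < ε) (hc : k * ε ≤ c) :
    ∃ m : ℕ, k ≤ m ∧ ε * m ∈ Set.Icc (c / 2) c := by
  have hfloor : k ≤ ⌊c / ε⌋₊ := Nat.le_floor ((le_div_iff₀ hε).mpr hc)
  have hfloor1 : (1 : ℝ) ≤ ⌊c / ε⌋₊ := mod_cast hk.trans_le hfloor
  have hc0 : 0 ≤ c := hc.trans' (by positivity)
  refine ⟨⌊c / ε⌋₊, hfloor, ?_, ?_⟩
  · have h : c / ε < 2 * ⌊c / ε⌋₊ := (Nat.lt_floor_add_one _).trans_le (by linarith)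
    rw [div_lt_iff₀ hε] at h
    linarith
  · rw [mul_comm, ← le_div_iff₀ hε]
    exact Nat.floor_le (by positivity)

end Conclusion

end BooleanCube

theorem mainTheorem4 :
    ∃ a b c : ℝ, 0 < a ∧ 0 < b ∧ 0 < c ∧
      ∀ ε : ℝ, 0 < ε → ε < 1 / 2 →
        ∃ k : ℕ, a / ε ^ 2 ≤ (k : ℝ) ∧ (k : ℝ) ≤ b / ε ^ 2 ∧
          ∃ f : (Fin k → Bool) → ℝ,
            (∀ x, f x ∈ Set.Icc (0 : ℝ) 1) ∧
            BooleanCube.IsXOS f ∧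
            c / ε ≤ (BooleanCube.approxDegree ε f : ℝ) := by
  set δ := BooleanCube.degreeConst
  have hδ : 0 < δ := BooleanCube.degreeConst_pos
  have hδ1 : δ ≤ 1 := BooleanCube.degreeConst_le_one
  refine ⟨(δ / 8) ^ 2, 1, δ ^ 2 / 8, by positivity, one_pos, by positivity, fun ε hε hε2 => ?_⟩
  simp only [div_le_iff₀ hε, div_le_iff₀ (pow_pos hε 2), le_div_iff₀ (pow_pos hε 2)]
  rcases le_or_gt (8 * ε) δ with hsmall | hlarge
  · obtain ⟨m, hm, hlow, hhigh⟩ :=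
      BooleanCube.exists_nat_mul_mem_Icc (k := 8) (by norm_num) hε hsmall
    obtain ⟨f, hf, hxos, hdeg⟩ := BooleanCube.exists_isXOS_approxDegree_ge hm hε.le hhigh
    refine ⟨m * m, ?_, ?_, f, hf, hxos, ?_⟩ <;> push_cast <;> nlinarith
  · obtain ⟨f, hf, hxos, hdeg⟩ := BooleanCube.exists_isXOS_one_le_approxDegree hε.le hε2 (0 : Fin 1)
    have hdeg' : (1 : ℝ) ≤ BooleanCube.approxDegree ε f := mod_cast hdeg
    refine ⟨1, ?_, ?_, f, hf, hxos, ?_⟩ <;> push_cast <;> nlinarith
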